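/- Let $d,M\ge 1$, $\mathcal X\subseteq\mathbb R^d$, and let $(X^*,\epsilon^*)$ be a random vector with values in $\mathcal X\times[0,1/2)^M$ and with a density $p_0(x,\epsilon)$ (for instance $\epsilon^*$ uniform and independent of $X^*$) whose differential entropy $H(p_0)=-\int p_0\log p_0$ is finite ($p_0\log p_0$ integrable). At each time $k=0,1,\dots$ a joint policy chooses, as a function of the earlier responses $\mathbf Y_1,\dots,\mathbf Y_k$, a batch $\mathbf A_k=(A_k^{(1)},\dots,A_k^{(M)})$ of query regions, where $A_k^{(m)}$ is a union of at most $J_k^{(m)}$ half-open rectangles contained in $\mathcal X$ (such batches are called admissible at time $k$). The $M$ players then give the responses $\mathbf Y_{k+1}\in\{0,1\}^M$ with $$\mathbb P(\mathbf Y_{k+1}=\mathbf y\mid X^*,\epsilon^*,\mathcal F_k)=\prod_{m=1}^M f_{I(X^*\in A_k^{(m)})}(y^{(m)}\mid\epsilon^*_m),\qquad f_j(y\mid e)=\begin{cases}1-e,&y=j,\\ e,&y\ne j,\end{cases}$$ where $\mathcal F_k=\sigma(\mathbf Y_1,\dots,\mathbf Y_k)$. Let $P_k$ be the conditional law of $(X^*,\epsilon^*)$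 given $\mathcal F_k$, let $g_i(\mathbf y\mid\epsilon)=\prod_m f_{i_m}(y^{(m)}\mid\epsilon_m)$ for $i\in\{0,1\}^M$, and, with $A^1=A$, $A^0=A^c$ and $H$ the Shannon entropy of a probability mass function, let $$G_k^*=\sup_{\mathbf A}\Big\{H\Big(\sum_{i}\int g_i(\cdot\mid\epsilon)\,P_k\big(\textstyle\bigcap_m (A^{(m)})^{i_m},d\epsilon\big)\Big)-\sum_{i}\int H\big(g_i(\cdot\mid\epsilon)\big)\,P_k\big(\textstyle\bigcap_m (A^{(m)})^{i_m},d\epsilon\big)\Big\},$$ the supremum being over the batches admissible at time $k$. All logarithms are natural. Then, for every such policy, in particular for an optimal one (one that attains $G_k^*$ at each time), and for every $n$, $$\frac{K}{2\pi e}\,d\,\exp\Big(-\frac{2n\bar C_n}{d}\Big)\le\mathbb E\big[\|X_n-X^*\|_2^2\big]+\mathbb E\big[\|\epsilon_n-\epsilon^*\|_2^2\big],$$ where $K=\exp(2H(p_0)/d)$, $X_n=\mathbb E[X^*\mid\mathcal F_n]$, $\epsilon_n=\mathbb E[\epsilon^*\mid\mathcal F_n]$, and $\bar C_n=\frac1n\sum_{k=0}^{n-1}\mathbb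 E[G_k^*]$ is the expected optimal entropy loss per iteration. (If $\mathbb E\|X^*\|_2^2=\infty$, the right-hand side is $+\infty$.) -/

import Mathlib

open MeasureTheory ProbabilityTheory

noncomputable section

namespace TwentyQuestions

/-- The joint parameter space of `(X*, ε*)`: target location in `ℝ^d`, error probabilities in
`ℝ^M`, each with its Euclidean norm. -/
abbrev Param (d M : ℕ) : Type := EuclideanSpace ℝ (Fin d) × EuclideanSpace ℝ (Fin M)

/-- One batch of responses `y = (y⁽¹⁾, …, y⁽ᴹ⁾)` of the `M` players. -/
abbrev Response (M : ℕ) : Type := Fin M → Bool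

/-- The responses received before the batch of queries number `k` is designed. -/
abbrev History (M k : ℕ) : Type := Fin k → Response M

/-- A batch of queries `A = (A⁽¹⁾, …, A⁽ᴹ⁾)`. -/
abbrev Query (d M : ℕ) : Type := Fin M → Set (EuclideanSpace ℝ (Fin d))

/-- A joint query policy: the batch asked at time `k` is a function of the responses so far. -/
abbrev Policy (d M : ℕ) : Type := ∀ k : ℕ, History M k → Query d M

/-- The half-open rectangle `[a₁, b₁) × ⋯ × [a_d, b_d)`. -/
def rectangle {d : ℕ} (a b : EuclideanSpace ℝ (Fin d)) : Set (EuclideanSpace ℝ (Fin d)) :=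
  {x | ∀ l, a l ≤ x l ∧ x l < b l}

/-- Query regularity: the query to player `m` is a union of at most `J m` half-open rectangles
contained in `𝒳` (a rectangle with `a l = b l` for some `l` is empty). -/
def Admissible {d M : ℕ} (𝒳 : Set (EuclideanSpace ℝ (Fin d))) (J : Fin M → ℕ)
    (A : Query d M) : Prop :=
  ∀ m, ∃ a b : Fin (J m) → EuclideanSpace ℝ (Fin d),
    (∀ j l, a j l ≤ b j l) ∧ (∀ j, rectangle (a j) (b j) ⊆ 𝒳) ∧
    A m = ⋃ j, rectangle (a j) (b j)

/-- The binary symmetric channel `f_j(y | e)` with crossover probability `e` and input `j`. -/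
def bsc (e : ℝ) (j y : Bool) : ℝ := if y = j then 1 - e else e

/-- `g_i(y | ε) = ∏ₘ f_{iₘ}(y⁽ᵐ⁾ | εₘ)`: conditionally independent players. -/
def channel {M : ℕ} (i y : Response M) (ε : EuclideanSpace ℝ (Fin M)) : ℝ :=
  ∏ m, bsc (ε m) (i m) (y m)

open Classical in
/-- The true answers `(1(x ∈ A⁽¹⁾), …, 1(x ∈ A⁽ᴹ⁾))` to a batch of queries. -/
def truth {d M : ℕ} (A : Query d M) (x : EuclideanSpace ℝ (Fin d)) : Response M :=
  fun m => decide (x ∈ A m)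

/-- The cell `⋂ₘ (A⁽ᵐ⁾)^{iₘ}`, where `A¹ = A` and `A⁰ = Aᶜ`. -/
def cell {d M : ℕ} (A : Query d M) (i : Response M) : Set (EuclideanSpace ℝ (Fin d)) :=
  ⋂ m, if i m = true then A m else (A m)ᶜ

/-- Shannon entropy (in nats) of a probability mass function on the responses. -/
def pmfEntropy {M : ℕ} (f : Response M → ℝ) : ℝ := ∑ y, Real.negMulLog (f y)

/-- Differential entropy (in nats) of a density on the parameter space. -/
def diffEntropy {d M : ℕ} (p : Param d M → ℝ) : ℝ := ∫ z, Real.negMulLog (p z)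

/-- The information gain of the batch `A` when `(X*, ε*)` has the (posterior) law `P`:
`H(∑ᵢ ∫ g_i(· | ε) P(cell_i, dε)) - ∑ᵢ ∫ H(g_i(· | ε)) P(cell_i, dε)`. -/
def gain {d M : ℕ} (P : Measure (Param d M)) (A : Query d M) : ℝ :=
  pmfEntropy (fun y => ∑ i : Response M, ∫ z in {z | z.1 ∈ cell A i}, channel i y z.2 ∂P)
    - ∑ i : Response M, ∫ z in {z | z.1 ∈ cell A i}, pmfEntropy (fun y => channel i y z.2) ∂P

/-- The optimal gain: supremum of the gain over the admissible batches of queries. -/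
def optimalGain {d M : ℕ} (𝒳 : Set (EuclideanSpace ℝ (Fin d))) (J : Fin M → ℕ)
    (P : Measure (Param d M)) : ℝ :=
  sSup (gain P '' {A | Admissible 𝒳 J A})

section Game

variable {Ω : Type*} [MeasurableSpace Ω] {d M : ℕ}

/-- The history at time `k`; `Y j` is the batch of responses to the batch of queries number `j`. -/
def hist (Y : ℕ → Ω → Response M) (k : ℕ) (ω : Ω) : History M k := fun j => Y j ω

/-- The information `ℱ_k` available at time `k`. As queries are functions of past responses, it is
generated by the responses. -/
abbrev info (Y : ℕ → Ω → Response M) (k : ℕ) : MeasurableSpace Ω :=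
  MeasurableSpace.comap (hist Y k) inferInstance

/-- The posterior law of `(X*, ε*)` at time `k` after the history `h`. -/
def posterior (μ : Measure Ω) (X : Ω → EuclideanSpace ℝ (Fin d))
    (ε : Ω → EuclideanSpace ℝ (Fin M)) (Y : ℕ → Ω → Response M) (k : ℕ) (h : History M k) :
    Measure (Param d M) :=
  (μ[|hist Y k ⁻¹' {h}]).map (fun ω => (X ω, ε ω))

/-- The responses are conditionally independent binary symmetric channels: given `X*`, `ε*` and
`ℱ_k`, the probability that the batch `Y k` equals `y` is `∏ₘ f_{1(X* ∈ A⁽ᵐ⁾)}(y⁽ᵐ⁾ | ε*ₘ)`,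
with `A` the batch that the policy asks at time `k`. -/
def FollowsModel (μ : Measure Ω) (X : Ω → EuclideanSpace ℝ (Fin d))
    (ε : Ω → EuclideanSpace ℝ (Fin M)) (Y : ℕ → Ω → Response M) (ζ : Policy d M) : Prop :=
  ∀ (k : ℕ) (y : Response M),
    μ[(Y k ⁻¹' {y}).indicator (fun _ => (1 : ℝ)) |
        MeasurableSpace.comap (fun ω => ((X ω, ε ω), hist Y k ω)) inferInstance]
      =ᵐ[μ] fun ω => channel (truth (ζ k (hist Y k ω)) (X ω)) y (ε ω)

/-- `C̄_n = (1/n) ∑_{k<n} 𝔼[G_k*]`: the expected optimal entropy loss per iteration, `G_k*` being the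
optimal gain at the (random) posterior at time `k`. -/
def averageGain (μ : Measure Ω) (X : Ω → EuclideanSpace ℝ (Fin d))
    (ε : Ω → EuclideanSpace ℝ (Fin M)) (Y : ℕ → Ω → Response M)
    (𝒳 : Set (EuclideanSpace ℝ (Fin d))) (J : ℕ → Fin M → ℕ) (n : ℕ) : ℝ :=
  (1 / (n : ℝ)) * ∑ k ∈ Finset.range n,
    ∫ ω, optimalGain 𝒳 (J k) (posterior μ X ε Y k (hist Y k ω)) ∂μ

end Game

end TwentyQuestions

end

open TwentyQuestions

/-!
Let `Z = (X*, ε*)`, and let `L` be the likelihood of the first `n` responses `Yⁿ`. For every weight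
`q h z` with mass at most one in `z`, dividing by `L` turns the observed responses into a sum over
all possible ones, so that `𝔼[q(Yⁿ, Z) ℙ(Yⁿ) / (p₀(Z) L(Z, Yⁿ))] ≤ 1`, and Jensen's inequality gives
`𝔼[log q(Yⁿ, Z)] ≤ 𝔼[log p₀(Z)] + H(Yⁿ) + 𝔼[log L(Z, Yⁿ)]`. The last two terms add up to the mutual
information of `Z` and the responses, which by the chain rule is the sum of the expected gains of
the queries. For `q` take a Gaussian density in `X*` centred at the estimator times the uniform
density on `[0, 1]^M`, to which the channel model confines the error probabilities: then `H(p₀)` is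
at most the sum of the gains plus `d/2 log(2πs) + MSE / (2s)`, for every variance `s`. The uniform
factor contributes nothing, so the error in `X*` alone obeys the bound, as one sees by letting `s`
be the claimed lower bound divided by `d`.
-/

noncomputable section

namespace TwentyQuestions

section FiniteFibers

variable {Ω β : Type*} [MeasurableSpace Ω] {μ : Measure Ω}

theorem ae_measureReal_fiber_pos [Countable β] [IsFiniteMeasure μ] (f : Ω → β) :
    ∀ᵐ ω ∂μ, 0 < μ.real (f ⁻¹' {f ω}) := by
  have hnull : ∀ b, ∀ᵐ ω ∂μ, μ.real (f ⁻¹' {b}) = 0 → f ω ≠ b := fun b => by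
    by_cases hb : μ.real (f ⁻¹' {b}) = 0
    · rw [measureReal_eq_zero_iff, measure_eq_zero_iff_ae_notMem] at hb
      exact hb.mono fun ω hω _ => hω
    · exact ae_of_all _ fun ω h => absurd h hb
  filter_upwards [ae_all_iff.2 hnull] with ω hω
  exact measureReal_nonneg.lt_of_ne' fun h => hω (f ω) h rfl

variable [MeasurableSpace β] [MeasurableSingletonClass β] {f : Ω → β}

theorem integrableOn_fiber_iff (hf : Measurable f) (F : β → Ω → ℝ) (b : β) :
    IntegrableOn (fun ω => F (f ω) ω) (f ⁻¹' {b}) μ ↔ IntegrableOn (F b) (f ⁻¹' {b}) μ :=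
  integrableOn_congr_fun (fun ω (hω : f ω = b) => by simp only [hω])
    (hf (measurableSet_singleton b))

theorem integrable_of_integrableOn_fiber [Finite β] (hf : Measurable f) {F : β → Ω → ℝ}
    (hF : ∀ b, IntegrableOn (F b) (f ⁻¹' {b}) μ) : Integrable (fun ω => F (f ω) ω) μ := by
  rw [← integrableOn_univ, ← Set.preimage_univ (f := f), ← Set.iUnion_of_singleton,
    Set.preimage_iUnion, integrableOn_finite_iUnion]
  exact fun b => (integrableOn_fiber_iff hf F b).2 (hF b)

variable [Fintype β]

theorem sum_restrict_fiber (hf : Measurable f) : ∑ b, μ.restrict (f ⁻¹' {b}) = μ := by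
  rw [← Measure.sum_fintype, ← Measure.restrict_iUnion
    (fun b c hbc => Disjoint.preimage f (by simpa using hbc))
    fun b => hf (measurableSet_singleton b), ← Set.preimage_iUnion, Set.iUnion_of_singleton,
    Set.preimage_univ, Measure.restrict_univ]

theorem lintegral_eq_sum_setLIntegral_fiber (hf : Measurable f) (F : β → Ω → ENNReal) :
    ∫⁻ ω, F (f ω) ω ∂μ = ∑ b, ∫⁻ ω in f ⁻¹' {b}, F b ω ∂μ := by
  conv_lhs => rw [← sum_restrict_fiber (μ := μ) hf, lintegral_finsetSum_measure]
  exact Finset.sum_congr rfl fun b _ => setLIntegral_congr_fun (hf (measurableSet_singleton b))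
    fun ω (hω : f ω = b) => by simp only [hω]

theorem integral_eq_sum_setIntegral_fiber (hf : Measurable f) {F : β → Ω → ℝ}
    (hF : ∀ b, IntegrableOn (F b) (f ⁻¹' {b}) μ) :
    ∫ ω, F (f ω) ω ∂μ = ∑ b, ∫ ω in f ⁻¹' {b}, F b ω ∂μ := by
  conv_lhs => rw [← sum_restrict_fiber (μ := μ) hf]
  rw [integral_finsetSum_measure fun b _ => (integrableOn_fiber_iff hf F b).2 (hF b)]
  exact Finset.sum_congr rfl fun b _ => setIntegral_congr_fun (hf (measurableSet_singleton b))
    fun ω (hω : f ω = b) => by simp only [hω]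

variable [IsFiniteMeasure μ]

theorem sum_measureReal_fiber (hf : Measurable f) :
    ∑ b, μ.real (f ⁻¹' {b}) = μ.real Set.univ := by
  rw [sum_measureReal_preimage_singleton _ fun b _ => hf (measurableSet_singleton b),
    Finset.coe_univ, Set.preimage_univ]

theorem integral_eq_sum_measureReal_mul_integral_cond (hf : Measurable f) {φ : Ω → ℝ}
    (hφ : Integrable φ μ) :
    ∫ ω, φ ω ∂μ = ∑ b, μ.real (f ⁻¹' {b}) * ∫ ω, φ ω ∂μ[|f ⁻¹' {b}] := by
  have hsum := sum_meas_smul_cond_fiber hf μ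
  have hφ_fiber : ∀ b ∈ Finset.univ, Integrable φ (μ (f ⁻¹' {b}) • μ[|f ⁻¹' {b}]) :=
    integrable_finsetSum_measure.1 (hsum.symm ▸ hφ)
  conv_lhs => rw [← hsum, integral_finsetSum_measure hφ_fiber]
  simp only [integral_smul_measure, smul_eq_mul, measureReal_def]

theorem integral_comp_eq_sum_measureReal_mul (hf : Measurable f) (φ : β → ℝ) :
    ∫ ω, φ (f ω) ∂μ = ∑ b, μ.real (f ⁻¹' {b}) * φ b := by
  rw [← integral_map hf.aemeasurable (measurable_of_finite φ).aestronglyMeasurable,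
    integral_fintype .of_finite]
  simp only [map_measureReal_apply hf (measurableSet_singleton _), smul_eq_mul]

end FiniteFibers

section ShannonEntropy

variable {Ω β γ : Type*} [MeasurableSpace Ω] {μ : Measure Ω} [Fintype β] [Fintype γ]

/-- The Shannon entropy (in nats) of the law of a finite-valued random variable. -/
def shannonEntropy (μ : Measure Ω) (f : Ω → β) : ℝ :=
  ∑ b, Real.negMulLog (μ.real (f ⁻¹' {b}))

theorem shannonEntropy_equiv_comp (f : Ω → β) (e : β ≃ γ) :
    shannonEntropy μ (fun ω => e (f ω)) = shannonEntropy μ f := by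
  unfold shannonEntropy
  rw [← e.sum_comp]
  congr! 4 with b
  ext ω
  simp

theorem shannonEntropy_of_subsingleton [Subsingleton β] [IsProbabilityMeasure μ] (f : Ω → β) :
    shannonEntropy μ f = 0 := by
  refine Finset.sum_eq_zero fun b _ => ?_
  have : f ⁻¹' {b} = Set.univ := Set.eq_univ_of_forall fun ω => Subsingleton.elim _ _
  rw [this, probReal_univ, Real.negMulLog_one]

variable [MeasurableSpace β] [MeasurableSingletonClass β] [MeasurableSpace γ]
  [MeasurableSingletonClass γ] [IsFiniteMeasure μ] {f : Ω → β} {g : Ω → γ}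

theorem integral_log_measureReal_fiber (hf : Measurable f) :
    ∫ ω, Real.log (μ.real (f ⁻¹' {f ω})) ∂μ = -shannonEntropy μ f := by
  rw [integral_comp_eq_sum_measureReal_mul hf fun b => Real.log (μ.real (f ⁻¹' {b})),
    shannonEntropy, ← Finset.sum_neg_distrib]
  simp only [Real.negMulLog, neg_mul, neg_neg]

theorem shannonEntropy_prodMk (hf : Measurable f) (hg : Measurable g) :
    shannonEntropy μ (fun ω => (f ω, g ω))
      = shannonEntropy μ f + ∑ b, μ.real (f ⁻¹' {b}) * shannonEntropy μ[|f ⁻¹' {b}] g := by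
  unfold shannonEntropy
  rw [Fintype.sum_prod_type, ← Finset.sum_add_distrib]
  refine Finset.sum_congr rfl fun b _ => ?_
  have hjoint : ∀ c, μ.real ((fun ω => (f ω, g ω)) ⁻¹' {(b, c)})
      = μ.real (f ⁻¹' {b}) * μ[|f ⁻¹' {b}].real (g ⁻¹' {c}) := fun c => by
    have : (fun ω => (f ω, g ω)) ⁻¹' {(b, c)} = f ⁻¹' {b} ∩ g ⁻¹' {c} := by ext; simp
    rw [this, measureReal_def, ← cond_mul_eq_inter (hf (measurableSet_singleton b)),
      ENNReal.toReal_mul, mul_comm]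
    rfl
  have hmarginal : (∑ c, μ[|f ⁻¹' {b}].real (g ⁻¹' {c})) * Real.negMulLog (μ.real (f ⁻¹' {b}))
      = Real.negMulLog (μ.real (f ⁻¹' {b})) := by
    rw [sum_measureReal_fiber hg]
    rcases eq_or_ne (μ (f ⁻¹' {b})) 0 with h0 | h0
    · simp [measureReal_def, h0]
    · have := cond_isProbabilityMeasure h0
      rw [probReal_univ, one_mul]
  simp only [hjoint, Real.negMulLog_mul, Finset.sum_add_distrib, ← Finset.sum_mul,
    ← Finset.mul_sum, hmarginal]

end ShannonEntropy

section Density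

variable {α : Type*} [MeasurableSpace α] {ρ : Measure α}

theorem ae_withDensity_ofReal_pos {p : α → ℝ} (hp : Measurable p) :
    ∀ᵐ z ∂ρ.withDensity (fun z => ENNReal.ofReal (p z)), 0 < p z := by
  rw [ae_withDensity_iff hp.ennreal_ofReal]
  exact ae_of_all _ fun z hz => by simpa using hz

theorem lintegral_div_withDensity_le {p f : α → ENNReal} (hp : Measurable p) (hf : Measurable f) :
    ∫⁻ z, f z / p z ∂ρ.withDensity p ≤ ∫⁻ z, f z ∂ρ := by
  simp only [lintegral_withDensity_eq_lintegral_mul ρ hp (hf.fun_div hp), Pi.mul_apply]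
  exact lintegral_mono fun z => ENNReal.mul_div_le

theorem integral_nonpos_of_lintegral_exp_le_one [IsProbabilityMeasure ρ] {S : α → ℝ}
    (hS : Integrable S ρ) (hexp : ∫⁻ z, ENNReal.ofReal (Real.exp (S z)) ∂ρ ≤ 1) :
    ∫ z, S z ∂ρ ≤ 0 := by
  have hmeas : AEStronglyMeasurable (fun z => Real.exp (S z)) ρ :=
    Real.continuous_exp.comp_aestronglyMeasurable hS.aestronglyMeasurable
  have hnonneg : 0 ≤ᵐ[ρ] fun z => Real.exp (S z) := ae_of_all _ fun z => (Real.exp_pos _).le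
  have hint : Integrable (fun z => Real.exp (S z)) ρ :=
    ⟨hmeas, (hasFiniteIntegral_iff_ofReal hnonneg).2 (hexp.trans_lt ENNReal.one_lt_top)⟩
  calc ∫ z, S z ∂ρ ≤ ∫ z, (Real.exp (S z) - 1) ∂ρ :=
        integral_mono hS (hint.sub (integrable_const 1)) fun z => by
          linarith [Real.add_one_le_exp (S z)]
    _ = ∫ z, Real.exp (S z) ∂ρ - 1 := by
        rw [integral_sub hint (integrable_const 1), integral_const, probReal_univ, one_smul]
    _ ≤ 0 := by
        rw [integral_eq_lintegral_of_nonneg_ae hnonneg hmeas, sub_nonpos]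
        exact ENNReal.toReal_le_of_le_ofReal zero_le_one (by simpa using hexp)

variable {Ω : Type*} [MeasurableSpace Ω] {μ : Measure Ω} {Z : Ω → α} {p : α → ℝ}

theorem map_eq_withDensity_restrict (hZ : Measurable Z) {s : Set α} (hs : MeasurableSet s)
    (hZs : ∀ᵐ ω ∂μ, Z ω ∈ s) {f : α → ENNReal} (hlaw : μ.map Z = ρ.withDensity f) :
    μ.map Z = (ρ.restrict s).withDensity f := by
  rw [← restrict_withDensity hs, ← hlaw, Measure.restrict_eq_self_of_ae_mem]
  exact (ae_map_iff hZ.aemeasurable hs).2 hZs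

theorem integrable_log_density_iff (hZ : Measurable Z) (hp : Measurable p)
    (hp_nonneg : ∀ z, 0 ≤ p z) (hlaw : μ.map Z = ρ.withDensity fun z => ENNReal.ofReal (p z)) :
    Integrable (fun ω => Real.log (p (Z ω))) μ
      ↔ Integrable (fun z => Real.negMulLog (p z)) ρ := by
  have hmap := integrable_map_measure (μ := μ) (f := Z) hp.log.aestronglyMeasurable hZ.aemeasurable
  rw [hlaw, integrable_withDensity_iff_integrable_smul' hp.ennreal_ofReal
    (ae_of_all _ fun _ => ENNReal.ofReal_lt_top)] at hmap
  refine hmap.symm.trans ?_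
  rw [← integrable_neg_iff]
  refine integrable_congr (ae_of_all _ fun z => ?_)
  simp [ENNReal.toReal_ofReal (hp_nonneg z), Real.negMulLog]

theorem integral_log_density (hZ : Measurable Z) (hp : Measurable p) (hp_nonneg : ∀ z, 0 ≤ p z)
    (hlaw : μ.map Z = ρ.withDensity fun z => ENNReal.ofReal (p z)) :
    ∫ ω, Real.log (p (Z ω)) ∂μ = -∫ z, Real.negMulLog (p z) ∂ρ := by
  rw [← integral_map hZ.aemeasurable hp.log.aestronglyMeasurable, hlaw,
    integral_withDensity_eq_integral_toReal_smul hp.ennreal_ofReal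
      (ae_of_all _ fun _ => ENNReal.ofReal_lt_top), ← integral_neg]
  simp only [ENNReal.toReal_ofReal (hp_nonneg _), Real.negMulLog, smul_eq_mul, neg_mul, neg_neg]

end Density

section Gaussian

variable {V : Type*} [NormedAddCommGroup V] [InnerProductSpace ℝ V]

/-- The density of the Gaussian law on `V` with mean `a` and covariance `s • 1`, in the form
`exp (log density)`. -/
def gaussianDensity (a : V) (s : ℝ) (x : V) : ℝ :=
  Real.exp (-(Module.finrank ℝ V / 2 * Real.log (2 * Real.pi * s) + ‖x - a‖ ^ 2 / (2 * s)))

theorem gaussianDensity_pos (a : V) (s : ℝ) (x : V) : 0 < gaussianDensity a s x :=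
  Real.exp_pos _

theorem log_gaussianDensity (a : V) (s : ℝ) (x : V) :
    Real.log (gaussianDensity a s x)
      = -(Module.finrank ℝ V / 2 * Real.log (2 * Real.pi * s) + ‖x - a‖ ^ 2 / (2 * s)) :=
  Real.log_exp _

theorem gaussianDensity_eq_mul (a : V) (s : ℝ) (x : V) :
    gaussianDensity a s x = Real.exp (-(Module.finrank ℝ V / 2 * Real.log (2 * Real.pi * s)))
      * Real.exp (-(1 / (2 * s)) * ‖x - a‖ ^ 2) := by
  rw [gaussianDensity, ← Real.exp_add]
  ring_nf

section Expectation

variable {Ω : Type*} [MeasurableSpace Ω] {μ : Measure Ω} {X A : Ω → V}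

theorem integrable_log_gaussianDensity [IsFiniteMeasure μ]
    (hXA : Integrable (fun ω => ‖X ω - A ω‖ ^ 2) μ) (s : ℝ) :
    Integrable (fun ω => Real.log (gaussianDensity (A ω) s (X ω))) μ := by
  simp only [log_gaussianDensity]
  exact ((integrable_const _).add (hXA.div_const _)).neg

theorem integral_log_gaussianDensity [IsProbabilityMeasure μ]
    (hXA : Integrable (fun ω => ‖X ω - A ω‖ ^ 2) μ) (s : ℝ) :
    ∫ ω, Real.log (gaussianDensity (A ω) s (X ω)) ∂μ
      = -(Module.finrank ℝ V / 2 * Real.log (2 * Real.pi * s)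
          + (∫ ω, ‖X ω - A ω‖ ^ 2 ∂μ) / (2 * s)) := by
  simp only [log_gaussianDensity]
  rw [integral_neg, integral_add (integrable_const _) (hXA.div_const _), integral_const,
    probReal_univ, one_smul, integral_div]

end Expectation

variable [MeasurableSpace V] [BorelSpace V]

theorem measurable_gaussianDensity (a : V) (s : ℝ) : Measurable (gaussianDensity a s) := by
  unfold gaussianDensity
  fun_prop

theorem integral_gaussianDensity [FiniteDimensional ℝ V] (a : V) {s : ℝ} (hs : 0 < s) :
    ∫ x, gaussianDensity a s x = 1 := by
  have hvar : Real.pi / (1 / (2 * s)) = 2 * Real.pi * s := by field_simp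
  simp only [gaussianDensity_eq_mul]
  rw [integral_const_mul,
    integral_sub_right_eq_self (fun v : V => Real.exp (-(1 / (2 * s)) * ‖v‖ ^ 2)) a,
    GaussianFourier.integral_rexp_neg_mul_sq_norm (by positivity), hvar,
    Real.rpow_def_of_pos (by positivity), ← Real.exp_add, Real.exp_eq_one_iff]
  ring

theorem lintegral_gaussianDensity [FiniteDimensional ℝ V] (a : V) {s : ℝ} (hs : 0 < s) :
    ∫⁻ x, ENNReal.ofReal (gaussianDensity a s x) = 1 := by
  have hint : Integrable (gaussianDensity a s) :=
    .of_integral_ne_zero (by rw [integral_gaussianDensity a hs]; exact one_ne_zero)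
  rw [← ofReal_integral_eq_lintegral_ofReal hint
    (ae_of_all _ fun x => (gaussianDensity_pos a s x).le), integral_gaussianDensity a hs,
    ENNReal.ofReal_one]

end Gaussian

theorem negMulLog_mem_Icc {x : ℝ} (hx : x ∈ Set.Icc (0 : ℝ) 1) :
    Real.negMulLog x ∈ Set.Icc (0 : ℝ) 1 :=
  ⟨Real.negMulLog_nonneg hx.1 hx.2,
    (Real.negMulLog_le_one_sub_self hx.1).trans (sub_le_self 1 hx.1)⟩

section ConditionalPMF

variable {Ω α β : Type*} [MeasurableSpace Ω] [MeasurableSpace α] {μ : Measure Ω}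
  {W : Ω → α} {Y : Ω → β} {p : β → α → ℝ}

/-- `p y w` is a version of the conditional probability that `Y = y` given that `W = w`. -/
def HasCondPMF (μ : Measure Ω) (Y : Ω → β) (W : Ω → α) (p : β → α → ℝ) : Prop :=
  ∀ y, μ[(Y ⁻¹' {y}).indicator (fun _ => (1 : ℝ)) | MeasurableSpace.comap W inferInstance]
    =ᵐ[μ] fun ω => p y (W ω)

namespace HasCondPMF

variable [IsFiniteMeasure μ] [MeasurableSpace β] [MeasurableSingletonClass β]

theorem ae_mem_Icc (h : HasCondPMF μ Y W p) (hY : Measurable Y) (hW : Measurable W) (y : β) :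
    ∀ᵐ ω ∂μ, p y (W ω) ∈ Set.Icc (0 : ℝ) 1 := by
  have hind : Integrable ((Y ⁻¹' {y}).indicator fun _ => (1 : ℝ)) μ :=
    (integrable_const 1).indicator (hY (measurableSet_singleton y))
  have h0 := condExp_nonneg (m := MeasurableSpace.comap W inferInstance) (μ := μ)
    (ae_of_all _ fun ω => Set.indicator_nonneg (s := Y ⁻¹' {y}) (fun _ _ => zero_le_one' ℝ) ω)
  have h1 := condExp_mono (m := MeasurableSpace.comap W inferInstance) hind (integrable_const 1)
    (ae_of_all _ fun ω => Set.indicator_le_self' (fun _ _ => zero_le_one' ℝ) ω)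
  rw [condExp_const hW.comap_le] at h1
  filter_upwards [h y, h0, h1] with ω hω h0ω h1ω
  rw [← hω]
  exact ⟨h0ω, h1ω⟩

theorem integrable_comp (h : HasCondPMF μ Y W p) (hY : Measurable Y) (hW : Measurable W)
    {y : β} (hp : Measurable (p y)) : Integrable (fun ω => p y (W ω)) μ :=
  .of_mem_Icc 0 1 (hp.comp hW).aemeasurable (h.ae_mem_Icc hY hW y)

theorem integrable_negMulLog_comp (h : HasCondPMF μ Y W p) (hY : Measurable Y)
    (hW : Measurable W) {y : β} (hp : Measurable (p y)) :
    Integrable (fun ω => Real.negMulLog (p y (W ω))) μ :=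
  .of_mem_Icc 0 1 (Real.continuous_negMulLog.measurable.comp (hp.comp hW)).aemeasurable
    ((h.ae_mem_Icc hY hW y).mono fun _ => negMulLog_mem_Icc)

theorem setIntegral_comp (h : HasCondPMF μ Y W p) (hY : Measurable Y) (hW : Measurable W) (y : β)
    {S : Set α} (hS : MeasurableSet S) :
    ∫ ω in W ⁻¹' S, p y (W ω) ∂μ = μ.real (W ⁻¹' S ∩ Y ⁻¹' {y}) := by
  have hYy : MeasurableSet (Y ⁻¹' {y}) := hY (measurableSet_singleton y)
  rw [← setIntegral_congr_ae (hW hS) ((h y).mono fun ω hω _ => hω),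
    setIntegral_condExp hW.comap_le ((integrable_const 1).indicator hYy) ⟨S, hS, rfl⟩,
    setIntegral_indicator hYy, setIntegral_const, smul_eq_mul, mul_one]

theorem integral_comp_cond (h : HasCondPMF μ Y W p) (hY : Measurable Y) (hW : Measurable W)
    (y : β) {S : Set α} (hS : MeasurableSet S) :
    ∫ ω, p y (W ω) ∂μ[|W ⁻¹' S] = μ[|W ⁻¹' S].real (Y ⁻¹' {y}) := by
  rw [measureReal_def, cond_apply (hW hS), ENNReal.toReal_mul, ← measureReal_def,
    ← h.setIntegral_comp hY hW y hS, ProbabilityTheory.cond, integral_smul_measure, smul_eq_mul]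

theorem map_restrict_fiber (h : HasCondPMF μ Y W p) (hY : Measurable Y) (hW : Measurable W)
    {y : β} (hp : Measurable (p y)) :
    (μ.restrict (Y ⁻¹' {y})).map W
      = (μ.map W).withDensity fun w => ENNReal.ofReal (p y w) := by
  ext S hS
  rw [Measure.map_apply hW hS, Measure.restrict_apply (hW hS), withDensity_apply _ hS,
    setLIntegral_map hS hp.ennreal_ofReal hW,
    ← ofReal_integral_eq_lintegral_ofReal (h.integrable_comp hY hW hp).integrableOn
      (ae_restrict_of_ae ((h.ae_mem_Icc hY hW y).mono fun _ hω => hω.1)),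
    h.setIntegral_comp hY hW y hS, ofReal_measureReal]

theorem setLIntegral_fiber_div_le (h : HasCondPMF μ Y W p) (hY : Measurable Y) (hW : Measurable W)
    {y : β} (hp : Measurable (p y)) {φ : α → ENNReal} (hφ : Measurable φ) :
    ∫⁻ ω in Y ⁻¹' {y}, φ (W ω) / ENNReal.ofReal (p y (W ω)) ∂μ ≤ ∫⁻ ω, φ (W ω) ∂μ := by
  rw [← lintegral_map (hφ.fun_div hp.ennreal_ofReal) hW, h.map_restrict_fiber hY hW hp,
    ← lintegral_map hφ hW]
  exact lintegral_div_withDensity_le hp.ennreal_ofReal hφ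

theorem integrableOn_fiber_comp_iff (h : HasCondPMF μ Y W p) (hY : Measurable Y)
    (hW : Measurable W) {y : β} (hp : Measurable (p y)) {φ : α → ℝ} (hφ : Measurable φ) :
    IntegrableOn (fun ω => φ (W ω)) (Y ⁻¹' {y}) μ
      ↔ Integrable (fun ω => p y (W ω) * φ (W ω)) μ := by
  have hmap := integrable_map_measure (μ := μ.restrict (Y ⁻¹' {y})) (f := W)
    hφ.aestronglyMeasurable hW.aemeasurable
  rw [h.map_restrict_fiber hY hW hp, integrable_withDensity_iff_integrable_smul'
    hp.ennreal_ofReal (ae_of_all _ fun _ => ENNReal.ofReal_lt_top), integrable_map_measure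
    (by fun_prop) hW.aemeasurable] at hmap
  refine hmap.symm.trans (integrable_congr ?_)
  filter_upwards [h.ae_mem_Icc hY hW y] with ω hω
  simp only [Function.comp_apply, ENNReal.toReal_ofReal hω.1, smul_eq_mul]

theorem setIntegral_fiber_comp (h : HasCondPMF μ Y W p) (hY : Measurable Y)
    (hW : Measurable W) {y : β} (hp : Measurable (p y)) {φ : α → ℝ} (hφ : Measurable φ) :
    ∫ ω in Y ⁻¹' {y}, φ (W ω) ∂μ = ∫ ω, p y (W ω) * φ (W ω) ∂μ := by
  rw [← integral_map hW.aemeasurable hφ.aestronglyMeasurable, h.map_restrict_fiber hY hW hp,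
    integral_withDensity_eq_integral_toReal_smul hp.ennreal_ofReal
      (ae_of_all _ fun _ => ENNReal.ofReal_lt_top),
    integral_map hW.aemeasurable (by fun_prop)]
  refine integral_congr_ae ?_
  filter_upwards [h.ae_mem_Icc hY hW y] with ω hω
  simp only [ENNReal.toReal_ofReal hω.1, smul_eq_mul]

theorem ae_pos [Countable β] (h : HasCondPMF μ Y W p) (hY : Measurable Y) (hW : Measurable W)
    (hp : ∀ y, Measurable (p y)) : ∀ᵐ ω ∂μ, 0 < p (Y ω) (W ω) := by
  have hfiber : ∀ y, ∀ᵐ ω ∂μ.restrict (Y ⁻¹' {y}), 0 < p y (W ω) := fun y =>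
    ae_of_ae_map hW.aemeasurable <| by
      rw [h.map_restrict_fiber hY hW (hp y)]
      exact ae_withDensity_ofReal_pos (hp y)
  filter_upwards [ae_all_iff.2 fun y =>
    (ae_restrict_iff' (hY (measurableSet_singleton y))).1 (hfiber y)] with ω hω
  exact hω (Y ω) rfl

theorem integrableOn_log_fiber (h : HasCondPMF μ Y W p) (hY : Measurable Y) (hW : Measurable W)
    {y : β} (hp : Measurable (p y)) :
    IntegrableOn (fun ω => Real.log (p y (W ω))) (Y ⁻¹' {y}) μ := by
  rw [h.integrableOn_fiber_comp_iff hY hW hp hp.log]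
  simpa [Real.negMulLog] using (h.integrable_negMulLog_comp hY hW hp).neg

theorem integrable_log [Finite β] (h : HasCondPMF μ Y W p) (hY : Measurable Y)
    (hW : Measurable W) (hp : ∀ y, Measurable (p y)) :
    Integrable (fun ω => Real.log (p (Y ω) (W ω))) μ :=
  integrable_of_integrableOn_fiber hY fun y => h.integrableOn_log_fiber hY hW (hp y)

variable [Fintype β]

theorem lintegral_div_le (h : HasCondPMF μ Y W p) (hY : Measurable Y) (hW : Measurable W)
    (hp : ∀ y, Measurable (p y)) {φ : β → α → ENNReal} (hφ : ∀ y, Measurable (φ y)) :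
    ∫⁻ ω, φ (Y ω) (W ω) / ENNReal.ofReal (p (Y ω) (W ω)) ∂μ ≤ ∑ y, ∫⁻ ω, φ y (W ω) ∂μ := by
  rw [lintegral_eq_sum_setLIntegral_fiber hY
    fun y ω => φ y (W ω) / ENNReal.ofReal (p y (W ω))]
  exact Finset.sum_le_sum fun y _ => h.setLIntegral_fiber_div_le hY hW (hp y) (hφ y)

theorem integral_log (h : HasCondPMF μ Y W p) (hY : Measurable Y) (hW : Measurable W)
    (hp : ∀ y, Measurable (p y)) :
    ∫ ω, Real.log (p (Y ω) (W ω)) ∂μ = -∑ y, ∫ ω, Real.negMulLog (p y (W ω)) ∂μ := by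
  rw [integral_eq_sum_setIntegral_fiber hY fun y => h.integrableOn_log_fiber hY hW (hp y),
    ← Finset.sum_neg_distrib]
  refine Finset.sum_congr rfl fun y _ => ?_
  rw [h.setIntegral_fiber_comp hY hW (hp y) (hp y).log, ← integral_neg]
  simp only [Real.negMulLog, neg_mul, neg_neg]

end HasCondPMF

end ConditionalPMF

section SequentialObservations

variable {Ω α β : Type*} {Z : Ω → α} {Y : ℕ → Ω → β} {p : ∀ k, β → α × (Fin k → β) → ℝ}

/-- The first `k` observations of the sequence `Y`. -/
def past (Y : ℕ → Ω → β) (k : ℕ) (ω : Ω) : Fin k → β := fun j => Y j ω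

theorem past_succ (k : ℕ) (ω : Ω) :
    past Y (k + 1) ω = Fin.snocEquiv (fun _ => β) (Y k ω, past Y k ω) := by
  ext j
  refine Fin.lastCases ?_ (fun i => ?_) j <;> simp [past]

/-- The likelihood of the first `k` observations, when `p k y (z, h)` is the conditional probability
of the observation `y` given the parameter `z` and the past `h`. -/
def likelihood (p : ∀ k, β → α × (Fin k → β) → ℝ) : ∀ k, α × (Fin k → β) → ℝ
  | 0, _ => 1
  | k + 1, w => likelihood p k (w.1, Fin.init w.2) * p k (w.2 (Fin.last k)) (w.1, Fin.init w.2)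

theorem likelihood_snocEquiv (k : ℕ) (z : α) (y : β) (h : Fin k → β) :
    likelihood p (k + 1) (z, Fin.snocEquiv (fun _ => β) (y, h))
      = likelihood p k (z, h) * p k y (z, h) := by
  have hinit : Fin.init (Fin.snocEquiv (fun _ => β) (y, h)) = h :=
    Fin.init_snoc (α := fun _ => β) y h
  simp only [likelihood, hinit, Fin.snocEquiv_apply, Fin.snoc_last]

variable [MeasurableSpace α] [MeasurableSpace β]

theorem measurable_likelihood [Countable β] [MeasurableSingletonClass β]
    (hp : ∀ k y, Measurable (p k y)) : ∀ k, Measurable (likelihood p k)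
  | 0 => measurable_const
  | k + 1 => by
    have hinit : Measurable fun w : α × (Fin (k + 1) → β) => (w.1, Fin.init w.2) :=
      measurable_fst.prodMk <| measurable_pi_lambda _ fun j =>
        (measurable_pi_apply j.castSucc).comp measurable_snd
    have hlast : Measurable fun w : α × (Fin (k + 1) → β) => w.2 (Fin.last k) :=
      (measurable_pi_apply _).comp measurable_snd
    have hp_uncurry : Measurable fun v : β × α × (Fin k → β) => p k v.1 v.2 :=
      measurable_from_prod_countable_right (hp k)
    exact ((measurable_likelihood hp k).comp hinit).mul (hp_uncurry.comp (hlast.prodMk hinit))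

variable [MeasurableSpace Ω] {μ : Measure Ω}

theorem measurable_past (hY : ∀ k, Measurable (Y k)) (k : ℕ) : Measurable (past Y k) :=
  measurable_pi_lambda _ fun j => hY j

variable [IsFiniteMeasure μ] [MeasurableSingletonClass β]

section Countable

variable [Countable β]

theorem ae_likelihood_pos (hZ : Measurable Z) (hY : ∀ k, Measurable (Y k))
    (hp : ∀ k y, Measurable (p k y))
    (hcond : ∀ k, HasCondPMF μ (Y k) (fun ω => (Z ω, past Y k ω)) (p k)) (n : ℕ) :
    ∀ᵐ ω ∂μ, 0 < likelihood p n (Z ω, past Y n ω) := by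
  induction n with
  | zero => exact ae_of_all _ fun _ => zero_lt_one' ℝ
  | succ k ih =>
    filter_upwards [ih, (hcond k).ae_pos (hY k) (hZ.prodMk (measurable_past hY k)) (hp k)]
      with ω hω hωk
    exact mul_pos hω hωk

theorem log_likelihood_succ_ae_eq (hZ : Measurable Z) (hY : ∀ k, Measurable (Y k))
    (hp : ∀ k y, Measurable (p k y))
    (hcond : ∀ k, HasCondPMF μ (Y k) (fun ω => (Z ω, past Y k ω)) (p k)) (k : ℕ) :
    (fun ω => Real.log (likelihood p (k + 1) (Z ω, past Y (k + 1) ω))) =ᵐ[μ] fun ω =>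
      Real.log (likelihood p k (Z ω, past Y k ω)) + Real.log (p k (Y k ω) (Z ω, past Y k ω)) := by
  filter_upwards [ae_likelihood_pos hZ hY hp hcond k,
    (hcond k).ae_pos (hY k) (hZ.prodMk (measurable_past hY k)) (hp k)] with ω hω hωk
  rw [past_succ, likelihood_snocEquiv, Real.log_mul hω.ne' hωk.ne']

end Countable

theorem integrable_log_likelihood [Finite β] (hZ : Measurable Z) (hY : ∀ k, Measurable (Y k))
    (hp : ∀ k y, Measurable (p k y))
    (hcond : ∀ k, HasCondPMF μ (Y k) (fun ω => (Z ω, past Y k ω)) (p k)) (n : ℕ) :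
    Integrable (fun ω => Real.log (likelihood p n (Z ω, past Y n ω))) μ := by
  induction n with
  | zero => exact integrable_const (Real.log 1)
  | succ k ih =>
    exact (ih.add ((hcond k).integrable_log (hY k) (hZ.prodMk (measurable_past hY k)) (hp k))).congr
      (log_likelihood_succ_ae_eq hZ hY hp hcond k).symm

section Fintype

variable [Fintype β]

theorem integral_log_likelihood (hZ : Measurable Z) (hY : ∀ k, Measurable (Y k))
    (hp : ∀ k y, Measurable (p k y))
    (hcond : ∀ k, HasCondPMF μ (Y k) (fun ω => (Z ω, past Y k ω)) (p k)) (n : ℕ) :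
    ∫ ω, Real.log (likelihood p n (Z ω, past Y n ω)) ∂μ
      = -∑ k ∈ Finset.range n, ∑ y, ∫ ω, Real.negMulLog (p k y (Z ω, past Y k ω)) ∂μ := by
  induction n with
  | zero => simp [likelihood]
  | succ k ih =>
    have hW := hZ.prodMk (measurable_past hY k)
    rw [integral_congr_ae (log_likelihood_succ_ae_eq hZ hY hp hcond k),
      integral_add (integrable_log_likelihood hZ hY hp hcond k)
        ((hcond k).integrable_log (hY k) hW (hp k)),
      ih, (hcond k).integral_log (hY k) hW (hp k), Finset.sum_range_succ, neg_add]

theorem sum_mul_shannonEntropy_cond_past (hY : ∀ k, Measurable (Y k)) (k : ℕ) :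
    ∑ h, μ.real (past Y k ⁻¹' {h}) * shannonEntropy μ[|past Y k ⁻¹' {h}] (Y k)
      = shannonEntropy μ (past Y (k + 1)) - shannonEntropy μ (past Y k) := by
  have hsucc : past Y (k + 1) = fun ω =>
      ((Equiv.prodComm _ _).trans (Fin.snocEquiv fun _ => β)) (past Y k ω, Y k ω) :=
    funext fun ω => past_succ k ω
  rw [hsucc, shannonEntropy_equiv_comp (fun ω => (past Y k ω, Y k ω)),
    shannonEntropy_prodMk (measurable_past hY k) (hY k), add_sub_cancel_left]

/-- Dividing by the likelihood decouples the observations from the parameter: in the bound they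
range over all possible values, with the counting measure. -/
theorem lintegral_div_likelihood_le (hZ : Measurable Z) (hY : ∀ k, Measurable (Y k))
    (hp : ∀ k y, Measurable (p k y))
    (hcond : ∀ k, HasCondPMF μ (Y k) (fun ω => (Z ω, past Y k ω)) (p k)) (n : ℕ)
    {ψ : α × (Fin n → β) → ENNReal} (hψ : Measurable ψ) :
    ∫⁻ ω, ψ (Z ω, past Y n ω) / ENNReal.ofReal (likelihood p n (Z ω, past Y n ω)) ∂μ
      ≤ ∑ h, ∫⁻ ω, ψ (Z ω, h) ∂μ := by
  induction n with
  | zero =>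
    rw [Fintype.sum_unique]
    refine lintegral_mono fun ω => ?_
    rw [likelihood, ENNReal.ofReal_one, div_one, Subsingleton.elim (past Y 0 ω)]
  | succ k ih =>
    have hW : Measurable fun ω => (Z ω, past Y k ω) := hZ.prodMk (measurable_past hY k)
    have hψ_snoc : ∀ y, Measurable fun w : α × (Fin k → β) =>
        ψ (w.1, Fin.snocEquiv (fun _ => β) (y, w.2)) := fun y =>
      hψ.comp <| measurable_fst.prodMk <|
        (measurable_of_finite fun h => Fin.snocEquiv (fun _ => β) (y, h)).comp measurable_snd
    calc ∫⁻ ω, ψ (Z ω, past Y (k + 1) ω)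
            / ENNReal.ofReal (likelihood p (k + 1) (Z ω, past Y (k + 1) ω)) ∂μ
        = ∫⁻ ω, ψ (Z ω, Fin.snocEquiv (fun _ => β) (Y k ω, past Y k ω))
            / ENNReal.ofReal (likelihood p k (Z ω, past Y k ω))
            / ENNReal.ofReal (p k (Y k ω) (Z ω, past Y k ω)) ∂μ := by
          refine lintegral_congr_ae ?_
          filter_upwards [ae_likelihood_pos hZ hY hp hcond k] with ω hω
          rw [past_succ, likelihood_snocEquiv, ENNReal.ofReal_mul hω.le, div_eq_mul_inv,
            ENNReal.mul_inv (.inr ENNReal.ofReal_ne_top) (.inl ENNReal.ofReal_ne_top),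
            ← mul_assoc]
          rfl
      _ ≤ ∑ y, ∫⁻ ω, ψ (Z ω, Fin.snocEquiv (fun _ => β) (y, past Y k ω))
            / ENNReal.ofReal (likelihood p k (Z ω, past Y k ω)) ∂μ :=
          (hcond k).lintegral_div_le (hY k) hW (hp k) fun y =>
            (hψ_snoc y).fun_div (measurable_likelihood hp k).ennreal_ofReal
      _ ≤ ∑ y, ∑ h, ∫⁻ ω, ψ (Z ω, Fin.snocEquiv (fun _ => β) (y, h)) ∂μ :=
          Finset.sum_le_sum fun y _ => ih (hψ_snoc y)
      _ = ∑ h, ∫⁻ ω, ψ (Z ω, h) ∂μ := by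
          rw [← (Fin.snocEquiv fun _ => β).sum_comp, Fintype.sum_prod_type]

/-- The mutual information of the parameter and the `k`-th observation, conditionally on the past
being `h`. -/
def observationInfo (μ : Measure Ω) (Z : Ω → α) (Y : ℕ → Ω → β)
    (p : ∀ k, β → α × (Fin k → β) → ℝ) (k : ℕ) (h : Fin k → β) : ℝ :=
  shannonEntropy μ[|past Y k ⁻¹' {h}] (Y k)
    - ∑ y, ∫ ω, Real.negMulLog (p k y (Z ω, past Y k ω)) ∂μ[|past Y k ⁻¹' {h}]

theorem integral_observationInfo (hZ : Measurable Z) (hY : ∀ k, Measurable (Y k))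
    (hp : ∀ k y, Measurable (p k y))
    (hcond : ∀ k, HasCondPMF μ (Y k) (fun ω => (Z ω, past Y k ω)) (p k)) (k : ℕ) :
    ∫ ω, observationInfo μ Z Y p k (past Y k ω) ∂μ
      = shannonEntropy μ (past Y (k + 1)) - shannonEntropy μ (past Y k)
        - ∑ y, ∫ ω, Real.negMulLog (p k y (Z ω, past Y k ω)) ∂μ := by
  have hH : Measurable (past Y k) := measurable_past hY k
  rw [integral_comp_eq_sum_measureReal_mul hH]
  simp only [observationInfo, mul_sub, Finset.sum_sub_distrib, Finset.mul_sum]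
  rw [sum_mul_shannonEntropy_cond_past hY, Finset.sum_comm]
  congr! 2 with y
  exact (integral_eq_sum_measureReal_mul_integral_cond hH
    ((hcond k).integrable_negMulLog_comp (hY k) (hZ.prodMk hH) (hp k y))).symm

/-- The chain rule for mutual information: the right-hand side is the mutual information of the
parameter and the first `n` observations. -/
theorem sum_integral_observationInfo [IsProbabilityMeasure μ] (hZ : Measurable Z)
    (hY : ∀ k, Measurable (Y k)) (hp : ∀ k y, Measurable (p k y))
    (hcond : ∀ k, HasCondPMF μ (Y k) (fun ω => (Z ω, past Y k ω)) (p k)) (n : ℕ) :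
    ∑ k ∈ Finset.range n, ∫ ω, observationInfo μ Z Y p k (past Y k ω) ∂μ
      = shannonEntropy μ (past Y n) + ∫ ω, Real.log (likelihood p n (Z ω, past Y n ω)) ∂μ := by
  simp only [integral_observationInfo hZ hY hp hcond]
  rw [Finset.sum_sub_distrib, Finset.sum_range_sub (fun k => shannonEntropy μ (past Y k)),
    shannonEntropy_of_subsingleton (past Y 0), integral_log_likelihood hZ hY hp hcond, sub_zero,
    sub_eq_add_neg]

end Fintype

section InformationInequality

variable {ρ : Measure α} {p₀ : α → ℝ} {n : ℕ} {q : (Fin n → β) → α → ℝ}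

theorem lintegral_density_ratio_le [Finite β] (hZ : Measurable Z) (hY : ∀ k, Measurable (Y k))
    (hp : ∀ k y, Measurable (p k y))
    (hcond : ∀ k, HasCondPMF μ (Y k) (fun ω => (Z ω, past Y k ω)) (p k)) (hp₀ : Measurable p₀)
    (hprior : μ.map Z = ρ.withDensity fun z => ENNReal.ofReal (p₀ z))
    (hq : ∀ h, Measurable (q h)) (hq_mass : ∀ h, ∫⁻ z, ENNReal.ofReal (q h z) ∂ρ ≤ 1) :
    ∫⁻ ω, μ (past Y n ⁻¹' {past Y n ω}) * (ENNReal.ofReal (q (past Y n ω) (Z ω))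
        / ENNReal.ofReal (p₀ (Z ω)))
        / ENNReal.ofReal (likelihood p n (Z ω, past Y n ω)) ∂μ ≤ μ Set.univ := by
  cases nonempty_fintype β
  have hratio : ∀ h, Measurable fun z => ENNReal.ofReal (q h z) / ENNReal.ofReal (p₀ z) :=
    fun h => (hq h).ennreal_ofReal.fun_div hp₀.ennreal_ofReal
  have hψ : Measurable fun w : α × (Fin n → β) => μ (past Y n ⁻¹' {w.2})
      * (ENNReal.ofReal (q w.2 w.1) / ENNReal.ofReal (p₀ w.1)) :=
    measurable_from_prod_countable_left fun h => (hratio h).const_mul (μ (past Y n ⁻¹' {h}))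
  refine (lintegral_div_likelihood_le hZ hY hp hcond n hψ).trans ?_
  have hslice : ∀ h, ∫⁻ ω, μ (past Y n ⁻¹' {h}) * (ENNReal.ofReal (q h (Z ω))
      / ENNReal.ofReal (p₀ (Z ω))) ∂μ ≤ μ (past Y n ⁻¹' {h}) := fun h => by
    rw [← lintegral_map ((hratio h).const_mul (μ (past Y n ⁻¹' {h}))) hZ,
      lintegral_const_mul _ (hratio h), hprior]
    exact mul_le_of_le_one_right' <|
      (lintegral_div_withDensity_le hp₀.ennreal_ofReal (hq h).ennreal_ofReal).trans (hq_mass h)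
  refine (Finset.sum_le_sum fun h _ => hslice h).trans_eq ?_
  rw [sum_measure_preimage_singleton _ fun h _ => measurable_past hY n (measurableSet_singleton h),
    Finset.coe_univ, Set.preimage_univ]

/-- Gibbs' inequality for the posterior density of `Z`, which is
`p₀ * likelihood / ℙ(past Y n = h)`. -/
theorem integral_log_density_le [Fintype β] [IsProbabilityMeasure μ]
    (hZ : Measurable Z) (hY : ∀ k, Measurable (Y k)) (hp : ∀ k y, Measurable (p k y))
    (hcond : ∀ k, HasCondPMF μ (Y k) (fun ω => (Z ω, past Y k ω)) (p k)) (hp₀ : Measurable p₀)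
    (hprior : μ.map Z = ρ.withDensity fun z => ENNReal.ofReal (p₀ z))
    (hq : ∀ h, Measurable (q h)) (hq_mass : ∀ h, ∫⁻ z, ENNReal.ofReal (q h z) ∂ρ ≤ 1)
    (hq_pos : ∀ᵐ ω ∂μ, 0 < q (past Y n ω) (Z ω))
    (hp₀_log : Integrable (fun ω => Real.log (p₀ (Z ω))) μ)
    (hq_log : Integrable (fun ω => Real.log (q (past Y n ω) (Z ω))) μ) :
    ∫ ω, Real.log (q (past Y n ω) (Z ω)) ∂μ
      ≤ ∫ ω, Real.log (p₀ (Z ω)) ∂μ + shannonEntropy μ (past Y n)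
        + ∫ ω, Real.log (likelihood p n (Z ω, past Y n ω)) ∂μ := by
  have hH : Measurable (past Y n) := measurable_past hY n
  have hL_log := integrable_log_likelihood hZ hY hp hcond n
  have hm_log : Integrable (fun ω => Real.log (μ.real (past Y n ⁻¹' {past Y n ω}))) μ :=
    (Integrable.of_finite (f := fun h => Real.log (μ.real (past Y n ⁻¹' {h})))).comp_measurable hH
  have hqm_log : Integrable (fun ω => Real.log (q (past Y n ω) (Z ω))
      + Real.log (μ.real (past Y n ⁻¹' {past Y n ω}))) μ := hq_log.add hm_log
  have hqmp_log : Integrable (fun ω => Real.log (q (past Y n ω) (Z ω))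
      + Real.log (μ.real (past Y n ⁻¹' {past Y n ω})) - Real.log (p₀ (Z ω))) μ :=
    hqm_log.sub hp₀_log
  have hp₀_pos : ∀ᵐ ω ∂μ, 0 < p₀ (Z ω) := ae_of_ae_map hZ.aemeasurable <| by
    rw [hprior]
    exact ae_withDensity_ofReal_pos hp₀
  have hgibbs : ∫ ω, (Real.log (q (past Y n ω) (Z ω))
      + Real.log (μ.real (past Y n ⁻¹' {past Y n ω})) - Real.log (p₀ (Z ω))
      - Real.log (likelihood p n (Z ω, past Y n ω))) ∂μ ≤ 0 := by
    refine integral_nonpos_of_lintegral_exp_le_one (hqmp_log.sub hL_log) ?_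
    refine (lintegral_congr_ae ?_).trans_le <|
      (lintegral_density_ratio_le hZ hY hp hcond hp₀ hprior hq hq_mass).trans_eq measure_univ
    filter_upwards [hq_pos, hp₀_pos, ae_likelihood_pos hZ hY hp hcond n,
      ae_measureReal_fiber_pos (past Y n)] with ω hqω hp₀ω hLω hmω
    rw [Real.exp_sub, Real.exp_sub, Real.exp_add, Real.exp_log hqω, Real.exp_log hmω,
      Real.exp_log hp₀ω, Real.exp_log hLω, ENNReal.ofReal_div_of_pos hLω,
      ENNReal.ofReal_div_of_pos hp₀ω, ENNReal.ofReal_mul hqω.le, ofReal_measureReal,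
      mul_comm, mul_div_assoc]
  rw [integral_sub hqmp_log hL_log, integral_sub hqm_log hp₀_log, integral_add hq_log hm_log,
    integral_log_measureReal_fiber hH] at hgibbs
  linarith

end InformationInequality

end SequentialObservations

section Channel

variable {d M : ℕ}

/-- The cube `[0, 1]^M` of the vectors of error probabilities. -/
def unitCube (M : ℕ) : Set (EuclideanSpace ℝ (Fin M)) :=
  {e | ∀ m, e m ∈ Set.Icc (0 : ℝ) 1}

theorem unitCube_eq_preimage_pi (M : ℕ) :
    unitCube M = WithLp.ofLp ⁻¹' Set.univ.pi fun _ => Set.Icc (0 : ℝ) 1 := by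
  ext e
  simp only [unitCube, Set.mem_preimage, Set.mem_univ_pi, Set.mem_ofPred_eq]

theorem measurableSet_unitCube : MeasurableSet (unitCube M) := by
  rw [unitCube_eq_preimage_pi]
  exact (PiLp.volume_preserving_ofLp (Fin M)).measurable
    (.univ_pi fun _ => measurableSet_Icc)

theorem volume_unitCube : volume (unitCube M) = 1 := by
  rw [unitCube_eq_preimage_pi, (PiLp.volume_preserving_ofLp (Fin M)).measure_preimage
    (MeasurableSet.univ_pi fun _ => measurableSet_Icc).nullMeasurableSet, volume_pi_pi]
  simp

theorem lintegral_fst_restrict_unitCube {φ : EuclideanSpace ℝ (Fin d) → ENNReal}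
    (hφ : Measurable φ) :
    ∫⁻ z in {z : Param d M | z.2 ∈ unitCube M}, φ z.1 = ∫⁻ x, φ x := by
  have hprod : (volume : Measure (Param d M)).restrict {z | z.2 ∈ unitCube M}
      = volume.prod (volume.restrict (unitCube M)) := by
    conv_rhs => rw [← Measure.restrict_univ (μ := volume), Measure.prod_restrict, Set.univ_prod]
    rfl
  rw [hprod, ← lintegral_map hφ measurable_fst, Measure.map_fst_prod,
    Measure.restrict_apply_univ, volume_unitCube, one_smul]

theorem sum_bsc (e : ℝ) (j : Bool) : ∑ b, bsc e j b = 1 := by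
  cases j <;> simp [bsc]

theorem forall_bsc_nonneg_iff {e : ℝ} {j : Bool} :
    (∀ b, 0 ≤ bsc e j b) ↔ e ∈ Set.Icc (0 : ℝ) 1 := by
  cases j <;> simp [bsc, and_comm]

theorem sum_channel (i : Response M) (e : EuclideanSpace ℝ (Fin M)) :
    ∑ y, channel i y e = 1 := by
  simp only [channel, ← Fintype.prod_sum, sum_bsc, Finset.prod_const_one]

theorem bsc_nonneg_of_channel_nonneg {i : Response M} {e : EuclideanSpace ℝ (Fin M)}
    (h : ∀ y, 0 ≤ channel i y e) (m : Fin M) (b : Bool) : 0 ≤ bsc (e m) (i m) b := by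
  have hpos : ∀ l, ∃ c, 0 < bsc (e l) (i l) c := fun l => by
    simpa only [Finset.mem_univ, true_and] using
      Finset.exists_lt_of_sum_lt (s := Finset.univ) (f := fun _ => (0 : ℝ)) (g := bsc (e l) (i l))
        (by rw [sum_bsc, Finset.sum_const_zero]; exact zero_lt_one)
  choose y hy using hpos
  have hupdate := h (Function.update y m b)
  rw [channel, ← Finset.mul_prod_erase _ _ (Finset.mem_univ m), Function.update_self] at hupdate
  refine nonneg_of_mul_nonneg_left hupdate (Finset.prod_pos fun l hl => ?_)
  rw [Function.update_of_ne (Finset.ne_of_mem_erase hl)]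
  exact hy l

theorem forall_channel_nonneg_iff {i : Response M} {e : EuclideanSpace ℝ (Fin M)} :
    (∀ y, 0 ≤ channel i y e) ↔ e ∈ unitCube M :=
  ⟨fun h m => forall_bsc_nonneg_iff.1 (bsc_nonneg_of_channel_nonneg h m),
    fun he y => Finset.prod_nonneg fun m _ => forall_bsc_nonneg_iff.2 (he m) (y m)⟩

theorem channel_mem_Icc (i y : Response M) {e : EuclideanSpace ℝ (Fin M)} (he : e ∈ unitCube M) :
    channel i y e ∈ Set.Icc (0 : ℝ) 1 := by
  have hnonneg := forall_channel_nonneg_iff (i := i).2 he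
  exact ⟨hnonneg y, sum_channel i e ▸
    Finset.single_le_sum (fun y _ => hnonneg y) (Finset.mem_univ y)⟩

theorem measurable_channel (i y : Response M) : Measurable (channel i y) := by
  refine Finset.measurable_prod _ fun m _ => ?_
  unfold bsc
  split_ifs <;> fun_prop

end Channel

section Query

variable {d M : ℕ} {𝒳 : Set (EuclideanSpace ℝ (Fin d))} {J : Fin M → ℕ} {A : Query d M}

theorem measurableSet_rectangle (a b : EuclideanSpace ℝ (Fin d)) :
    MeasurableSet (rectangle a b) := by
  simp only [rectangle, Set.ofPred_forall]
  measurability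

theorem Admissible.measurableSet (hA : Admissible 𝒳 J A) (m : Fin M) : MeasurableSet (A m) := by
  obtain ⟨a, b, -, -, hAm⟩ := hA m
  rw [hAm]
  exact .iUnion fun j => measurableSet_rectangle (a j) (b j)

theorem truth_preimage_singleton (A : Query d M) (i : Response M) :
    truth A ⁻¹' {i} = cell A i := by
  ext x
  simp only [cell, truth, Set.mem_preimage, Set.mem_singleton_iff, Set.mem_iInter, funext_iff]
  refine forall_congr' fun m => ?_
  cases i m <;> simp

theorem measurable_truth (hA : ∀ m, MeasurableSet (A m)) : Measurable (truth A) := by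
  refine measurable_to_countable' fun i => ?_
  rw [truth_preimage_singleton]
  refine .iInter fun m => ?_
  split_ifs
  exacts [hA m, (hA m).compl]

/-- The probability of the batch of responses `y` to the batch of queries `A` when the parameter is
`z`. -/
def queryLik (A : Query d M) (y : Response M) (z : Param d M) : ℝ :=
  channel (truth A z.1) y z.2

theorem measurable_queryLik (hA : ∀ m, MeasurableSet (A m)) (y : Response M) :
    Measurable (queryLik A y) := by
  have hchannel : Measurable fun v : Response M × EuclideanSpace ℝ (Fin M) => channel v.1 y v.2 :=
    measurable_from_prod_countable_right fun i => measurable_channel i y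
  exact hchannel.comp (((measurable_truth hA).comp measurable_fst).prodMk measurable_snd)

variable {P : Measure (Param d M)}

theorem sum_setIntegral_cell (hA : ∀ m, MeasurableSet (A m)) {F : Response M → Param d M → ℝ}
    (hF : ∀ i, Integrable (F i) P) :
    ∑ i, ∫ z in {z | z.1 ∈ cell A i}, F i z ∂P = ∫ z, F (truth A z.1) z ∂P := by
  have hcell : ∀ i, {z : Param d M | z.1 ∈ cell A i} = (fun z => truth A z.1) ⁻¹' {i} :=
    fun i => congrArg (Prod.fst ⁻¹' ·) (truth_preimage_singleton A i).symm
  simp only [hcell]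
  exact (integral_eq_sum_setIntegral_fiber ((measurable_truth hA).comp measurable_fst)
    fun i => (hF i).integrableOn).symm

variable [IsFiniteMeasure P]

theorem integrable_negMulLog_queryLik (hA : ∀ m, MeasurableSet (A m))
    (hP : ∀ᵐ z ∂P, z.2 ∈ unitCube M) (y : Response M) :
    Integrable (fun z => Real.negMulLog (queryLik A y z)) P :=
  .of_mem_Icc 0 1
    (Real.continuous_negMulLog.measurable.comp (measurable_queryLik hA y)).aemeasurable
    (hP.mono fun z hz => negMulLog_mem_Icc (channel_mem_Icc (truth A z.1) y hz))

theorem gain_eq (hA : ∀ m, MeasurableSet (A m)) (hP : ∀ᵐ z ∂P, z.2 ∈ unitCube M) :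
    gain P A = ∑ y, Real.negMulLog (∫ z, queryLik A y z ∂P)
      - ∑ y, ∫ z, Real.negMulLog (queryLik A y z) ∂P := by
  have hchannel_meas : ∀ i y : Response M, Measurable fun z : Param d M => channel i y z.2 :=
    fun i y => (measurable_channel i y).comp measurable_snd
  have hchannel : ∀ i y : Response M, Integrable (fun z : Param d M => channel i y z.2) P :=
    fun i y => .of_mem_Icc 0 1 (hchannel_meas i y).aemeasurable
      (hP.mono fun z hz => channel_mem_Icc i y hz)
  have hentropy : ∀ i : Response M,
      Integrable (fun z : Param d M => ∑ y, Real.negMulLog (channel i y z.2)) P := fun i =>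
    integrable_finsetSum _ fun y _ => .of_mem_Icc 0 1
      (Real.continuous_negMulLog.measurable.comp (hchannel_meas i y)).aemeasurable
      (hP.mono fun z hz => negMulLog_mem_Icc (channel_mem_Icc i y hz))
  unfold gain pmfEntropy
  rw [sum_setIntegral_cell hA hentropy, ← integral_finsetSum _ fun y _ =>
    integrable_negMulLog_queryLik hA hP y]
  simp only [sum_setIntegral_cell hA fun i => hchannel i _, queryLik]

theorem gain_le_card (hA : ∀ m, MeasurableSet (A m)) (hP : ∀ᵐ z ∂P, z.2 ∈ unitCube M) :
    gain P A ≤ Fintype.card (Response M) := by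
  have hresponse : ∀ y, Real.negMulLog (∫ z, queryLik A y z ∂P) ≤ 1 := fun y =>
    have h0 : 0 ≤ ∫ z, queryLik A y z ∂P :=
      integral_nonneg_of_ae (hP.mono fun z hz => (channel_mem_Icc (truth A z.1) y hz).1)
    (Real.negMulLog_le_one_sub_self h0).trans (sub_le_self 1 h0)
  have hnoise : 0 ≤ ∑ y, ∫ z, Real.negMulLog (queryLik A y z) ∂P :=
    Finset.sum_nonneg fun y _ => integral_nonneg_of_ae <| hP.mono fun z hz =>
      (negMulLog_mem_Icc (channel_mem_Icc (truth A z.1) y hz)).1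
  calc gain P A ≤ ∑ y, Real.negMulLog (∫ z, queryLik A y z ∂P) :=
        (gain_eq hA hP).trans_le (sub_le_self _ hnoise)
    _ ≤ Fintype.card (Response M) := by
        simpa using Finset.sum_le_card_nsmul Finset.univ _ 1 fun y _ => hresponse y

theorem gain_le_optimalGain (hA : Admissible 𝒳 J A) (hP : ∀ᵐ z ∂P, z.2 ∈ unitCube M) :
    gain P A ≤ optimalGain 𝒳 J P := by
  refine le_csSup ⟨Fintype.card (Response M), ?_⟩ ⟨A, hA, rfl⟩
  rintro _ ⟨B, hB, rfl⟩
  exact gain_le_card (Admissible.measurableSet hB) hP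

end Query

section Game

variable {Ω : Type*} [MeasurableSpace Ω] {μ : Measure Ω} {d M n : ℕ}
  {X : Ω → EuclideanSpace ℝ (Fin d)} {ε : Ω → EuclideanSpace ℝ (Fin M)}
  {Y : ℕ → Ω → Response M} {ζ : Policy d M} {𝒳 : Set (EuclideanSpace ℝ (Fin d))}
  {J : ℕ → Fin M → ℕ} {p₀ : Param d M → ℝ}

/-- The probability of the `k`-th batch of responses `y` given the parameter and the history, under
the policy `ζ`. -/
def responseLik (ζ : Policy d M) (k : ℕ) (y : Response M) (w : Param d M × History M k) : ℝ :=
  queryLik (ζ k w.2) y w.1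

theorem measurable_responseLik (hζ : ∀ k h m, MeasurableSet (ζ k h m)) (k : ℕ) (y : Response M) :
    Measurable (responseLik ζ k y) :=
  measurable_from_prod_countable_left fun h => measurable_queryLik (hζ k h) y

theorem FollowsModel.hasCondPMF (hmodel : FollowsModel μ X ε Y ζ) (k : ℕ) :
    HasCondPMF μ (Y k) (fun ω => ((X ω, ε ω), past Y k ω)) (responseLik ζ k) :=
  hmodel k

theorem integral_posterior (hX : Measurable X) (hε : Measurable ε) (hY : ∀ k, Measurable (Y k))
    {k : ℕ} {φ : Param d M × History M k → ℝ} (hφ : Measurable φ) (h : History M k) :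
    ∫ z, φ (z, h) ∂posterior μ X ε Y k h
      = ∫ ω, φ ((X ω, ε ω), past Y k ω) ∂μ[|past Y k ⁻¹' {h}] := by
  have hpast : ∀ᵐ ω ∂μ[|past Y k ⁻¹' {h}], past Y k ω = h :=
    ae_cond_mem (measurable_past hY k (measurableSet_singleton h))
  have hφh : Measurable fun z => φ (z, h) := hφ.comp measurable_prodMk_right
  rw [posterior, integral_map (hX.prodMk hε).aemeasurable hφh.aestronglyMeasurable]
  exact integral_congr_ae (hpast.mono fun ω hω => by simp only [hω])

theorem natCast_mul_averageGain (n : ℕ) :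
    n * averageGain μ X ε Y 𝒳 J n = ∑ k ∈ Finset.range n,
      ∫ ω, optimalGain 𝒳 (J k) (posterior μ X ε Y k (hist Y k ω)) ∂μ := by
  rcases eq_or_ne n 0 with rfl | hn
  · simp
  · rw [averageGain, one_div, mul_inv_cancel_left₀ (Nat.cast_ne_zero.2 hn)]

variable [IsFiniteMeasure μ]

instance isFiniteMeasure_posterior (k : ℕ) (h : History M k) :
    IsFiniteMeasure (posterior μ X ε Y k h) := by
  unfold posterior
  infer_instance

/-- All the values of the channel are conditional probabilities, so the model by itself forces the
error probabilities into `[0, 1]`. -/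
theorem FollowsModel.ae_mem_unitCube (hmodel : FollowsModel μ X ε Y ζ) (hX : Measurable X)
    (hε : Measurable ε) (hY : ∀ k, Measurable (Y k)) : ∀ᵐ ω ∂μ, ε ω ∈ unitCube M := by
  filter_upwards [ae_all_iff.2 fun y => (hmodel.hasCondPMF 0).ae_mem_Icc (hY 0)
    ((hX.prodMk hε).prodMk (measurable_past hY 0)) y] with ω hω
  exact forall_channel_nonneg_iff.1 fun y => (hω y).1

theorem ae_posterior_mem_unitCube (hmodel : FollowsModel μ X ε Y ζ) (hX : Measurable X)
    (hε : Measurable ε) (hY : ∀ k, Measurable (Y k)) (k : ℕ) (h : History M k) :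
    ∀ᵐ z ∂posterior μ X ε Y k h, z.2 ∈ unitCube M :=
  (ae_map_iff (hX.prodMk hε).aemeasurable (measurable_snd measurableSet_unitCube)).2 <|
    cond_absolutelyContinuous.ae_le (hmodel.ae_mem_unitCube hX hε hY)

theorem gain_posterior (hmodel : FollowsModel μ X ε Y ζ) (hX : Measurable X) (hε : Measurable ε)
    (hY : ∀ k, Measurable (Y k)) (hζ : ∀ k h m, MeasurableSet (ζ k h m)) (k : ℕ)
    (h : History M k) :
    gain (posterior μ X ε Y k h) (ζ k h)
      = observationInfo μ (fun ω => (X ω, ε ω)) Y (responseLik ζ) k h := by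
  have hlik := measurable_responseLik hζ k
  have hresponse : ∀ y, ∫ z, queryLik (ζ k h) y z ∂posterior μ X ε Y k h
      = μ[|past Y k ⁻¹' {h}].real (Y k ⁻¹' {y}) := fun y =>
    (integral_posterior hX hε hY (hlik y) h).trans <| (hmodel.hasCondPMF k).integral_comp_cond
      (hY k) ((hX.prodMk hε).prodMk (measurable_past hY k)) y
      (measurable_snd (measurableSet_singleton h))
  have hnoise : ∀ y, ∫ z, Real.negMulLog (queryLik (ζ k h) y z) ∂posterior μ X ε Y k h
      = ∫ ω, Real.negMulLog (responseLik ζ k y ((X ω, ε ω), past Y k ω))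
          ∂μ[|past Y k ⁻¹' {h}] := fun y =>
    integral_posterior hX hε hY (Real.continuous_negMulLog.measurable.comp (hlik y)) h
  rw [gain_eq (hζ k h) (ae_posterior_mem_unitCube hmodel hX hε hY k h)]
  simp only [hresponse, hnoise, observationInfo, shannonEntropy]

theorem sum_integral_gain_le (hmodel : FollowsModel μ X ε Y ζ) (hX : Measurable X)
    (hε : Measurable ε) (hY : ∀ k, Measurable (Y k))
    (hζ : ∀ k h, Admissible 𝒳 (J k) (ζ k h)) (n : ℕ) :
    ∑ k ∈ Finset.range n, ∫ ω, gain (posterior μ X ε Y k (hist Y k ω)) (ζ k (hist Y k ω)) ∂μ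
      ≤ n * averageGain μ X ε Y 𝒳 J n := by
  rw [natCast_mul_averageGain]
  refine Finset.sum_le_sum fun k _ => ?_
  have hhist : Measurable (hist Y k) := measurable_past hY k
  rw [integral_comp_eq_sum_measureReal_mul hhist fun h => gain (posterior μ X ε Y k h) (ζ k h),
    integral_comp_eq_sum_measureReal_mul hhist fun h => optimalGain 𝒳 (J k) (posterior μ X ε Y k h)]
  exact Finset.sum_le_sum fun h _ => mul_le_mul_of_nonneg_left
    (gain_le_optimalGain (hζ k h) (ae_posterior_mem_unitCube hmodel hX hε hY k h))
    measureReal_nonneg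

theorem sum_integral_gain [IsProbabilityMeasure μ] (hmodel : FollowsModel μ X ε Y ζ)
    (hX : Measurable X) (hε : Measurable ε) (hY : ∀ k, Measurable (Y k))
    (hζ : ∀ k h m, MeasurableSet (ζ k h m)) (n : ℕ) :
    ∑ k ∈ Finset.range n, ∫ ω, gain (posterior μ X ε Y k (hist Y k ω)) (ζ k (hist Y k ω)) ∂μ
      = shannonEntropy μ (past Y n)
        + ∫ ω, Real.log (likelihood (responseLik ζ) n ((X ω, ε ω), past Y n ω)) ∂μ := by
  simp only [gain_posterior hmodel hX hε hY hζ]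
  exact sum_integral_observationInfo (hX.prodMk hε) hY (measurable_responseLik hζ)
    hmodel.hasCondPMF n

theorem diffEntropy_le [IsProbabilityMeasure μ] (hmodel : FollowsModel μ X ε Y ζ)
    (hX : Measurable X) (hε : Measurable ε) (hY : ∀ k, Measurable (Y k))
    (hζ : ∀ k h m, MeasurableSet (ζ k h m)) (hp₀ : Measurable p₀) (hp₀_nonneg : ∀ z, 0 ≤ p₀ z)
    (hp₀_entropy : Integrable fun z => Real.negMulLog (p₀ z))
    (hprior : μ.map (fun ω => (X ω, ε ω)) = volume.withDensity fun z => ENNReal.ofReal (p₀ z))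
    (a : History M n → EuclideanSpace ℝ (Fin d))
    (ha : Integrable (fun ω => ‖X ω - a (hist Y n ω)‖ ^ 2) μ) {s : ℝ} (hs : 0 < s) :
    diffEntropy p₀
      ≤ ∑ k ∈ Finset.range n, ∫ ω, gain (posterior μ X ε Y k (hist Y k ω)) (ζ k (hist Y k ω)) ∂μ
        + (d / 2 * Real.log (2 * Real.pi * s)
          + (∫ ω, ‖X ω - a (hist Y n ω)‖ ^ 2 ∂μ) / (2 * s)) := by
  have hZ : Measurable fun ω => (X ω, ε ω) := hX.prodMk hε
  have hq : ∀ h, Measurable fun z : Param d M => gaussianDensity (a h) s z.1 := fun h =>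
    (measurable_gaussianDensity (a h) s).comp measurable_fst
  have hq_mass : ∀ h, ∫⁻ z in {z : Param d M | z.2 ∈ unitCube M},
      ENNReal.ofReal (gaussianDensity (a h) s z.1) ≤ 1 := fun h => by
    rw [lintegral_fst_restrict_unitCube (measurable_gaussianDensity (a h) s).ennreal_ofReal,
      lintegral_gaussianDensity (a h) hs]
  have hprior_cube := map_eq_withDensity_restrict hZ (measurable_snd measurableSet_unitCube)
    (hmodel.ae_mem_unitCube hX hε hY) hprior
  have hp₀_log := (integrable_log_density_iff hZ hp₀ hp₀_nonneg hprior).2 hp₀_entropy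
  have hbound := integral_log_density_le hZ hY (measurable_responseLik hζ) hmodel.hasCondPMF hp₀
    hprior_cube hq hq_mass (ae_of_all _ fun ω => gaussianDensity_pos _ s (X ω)) hp₀_log
    (integrable_log_gaussianDensity ha s)
  have hentropy : ∫ ω, Real.log (p₀ (X ω, ε ω)) ∂μ = -diffEntropy p₀ :=
    integral_log_density hZ hp₀ hp₀_nonneg hprior
  rw [hentropy, add_assoc, ← sum_integral_gain hmodel hX hε hY hζ] at hbound
  have hgauss := (integral_log_gaussianDensity ha s).ge.trans hbound
  rw [finrank_euclideanSpace_fin] at hgauss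
  linarith

end Game

section EntropyPower

theorem exp_div_mul_le_of_forall_le {H D d : ℝ} (hd : 0 < d)
    (h : ∀ s > 0, H ≤ d / 2 * Real.log (2 * Real.pi * s) + D / (2 * s)) :
    Real.exp (2 * H / d) / (2 * Real.pi * Real.exp 1) * d ≤ D := by
  set s := Real.exp (2 * H / d) / (2 * Real.pi * Real.exp 1) with hs
  have hs_pos : 0 < s := by positivity
  have hlog : d / 2 * Real.log (2 * Real.pi * s) = H - d / 2 := by
    have hexp : 2 * Real.pi * s = Real.exp (2 * H / d - 1) := by
      rw [hs, Real.exp_sub]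
      field_simp
    rw [hexp, Real.log_exp]
    field_simp
  have hD : d / 2 ≤ D / (2 * s) := by linarith [h s hs_pos]
  rw [le_div_iff₀ (by positivity)] at hD
  linarith

theorem ofReal_le_lintegral_enorm_sq {Ω E : Type*} [MeasurableSpace Ω] {μ : Measure Ω}
    [NormedAddCommGroup E] {f : Ω → E} (hf : AEStronglyMeasurable f μ) {c : ℝ}
    (h : Integrable (fun ω => ‖f ω‖ ^ 2) μ → c ≤ ∫ ω, ‖f ω‖ ^ 2 ∂μ) :
    ENNReal.ofReal c ≤ ∫⁻ ω, ‖f ω‖ₑ ^ 2 ∂μ := by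
  have henorm : ∀ ω, ‖‖f ω‖ ^ 2‖ₑ = ‖f ω‖ₑ ^ 2 := fun ω => by rw [enorm_pow, enorm_norm]
  by_cases hint : Integrable (fun ω => ‖f ω‖ ^ 2) μ
  · refine (ENNReal.ofReal_le_ofReal (h hint)).trans_eq ?_
    simp only [ofReal_integral_eq_lintegral_ofReal hint (ae_of_all _ fun _ => sq_nonneg _),
      ← henorm, ← Real.enorm_of_nonneg (sq_nonneg _)]
  · have htop : ∫⁻ ω, ‖f ω‖ₑ ^ 2 ∂μ = ⊤ := by
      by_contra hfin
      refine hint ⟨hf.norm.pow 2, ?_⟩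
      simpa only [HasFiniteIntegral, henorm] using lt_top_iff_ne_top.2 hfin
    exact le_top.trans_eq htop.symm

end EntropyPower

end TwentyQuestions

end

theorem theorem8_general {Ω : Type*} [MeasurableSpace Ω] (μ : Measure Ω) [IsProbabilityMeasure μ]
    {d M : ℕ} (𝒳 : Set (EuclideanSpace ℝ (Fin d)))
    (p₀ : Param d M → ℝ) (hp₀_meas : Measurable p₀) (hp₀_nonneg : ∀ z, 0 ≤ p₀ z)
    (hp₀_entropy : Integrable (fun z => Real.negMulLog (p₀ z)))
    (X : Ω → EuclideanSpace ℝ (Fin d)) (hX : Measurable X)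
    (ε : Ω → EuclideanSpace ℝ (Fin M)) (hε : Measurable ε)
    (Y : ℕ → Ω → Response M) (hY : ∀ k, Measurable (Y k))
    (hprior : μ.map (fun ω => (X ω, ε ω)) = volume.withDensity (fun z => ENNReal.ofReal (p₀ z)))
    (J : ℕ → Fin M → ℕ) (ζ : Policy d M) (hζ : ∀ k h, Admissible 𝒳 (J k) (ζ k h))
    (hmodel : FollowsModel μ X ε Y ζ) (n : ℕ)
    {Xhat : Ω → EuclideanSpace ℝ (Fin d)} (hXhat : StronglyMeasurable[info Y n] Xhat) :
    ENNReal.ofReal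
        (Real.exp (2 * diffEntropy p₀ / d) / (2 * Real.pi * Real.exp 1) * d *
          Real.exp (-(2 * n * averageGain μ X ε Y 𝒳 J n) / d))
      ≤ ∫⁻ ω, ‖Xhat ω - X ω‖ₑ ^ 2 ∂μ := by
  rcases Nat.eq_zero_or_pos d with rfl | hd
  · simp
  obtain ⟨a, -, rfl⟩ := hXhat.exists_eq_measurable_comp
  simp only [Function.comp_apply, enorm_sub_rev (a _)]
  have hinfo : info Y n ≤ ‹MeasurableSpace Ω› := (measurable_past hY n).comap_le
  refine ofReal_le_lintegral_enorm_sq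
    (hX.aestronglyMeasurable.sub (hXhat.mono hinfo).aestronglyMeasurable) fun hint => ?_
  refine (Eq.le ?_).trans <| exp_div_mul_le_of_forall_le
    (H := diffEntropy p₀ - n * averageGain μ X ε Y 𝒳 J n) (Nat.cast_pos.2 hd) fun s hs => ?_
  · rw [mul_sub, sub_div, sub_eq_add_neg, Real.exp_add, ← neg_div, ← mul_assoc]
    ring
  · have hentropy := diffEntropy_le hmodel hX hε hY (fun k h => (hζ k h).measurableSet) hp₀_meas
      hp₀_nonneg hp₀_entropy hprior a hint hs
    exact sub_le_iff_le_add'.2 <| hentropy.trans <|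
      add_le_add (sum_integral_gain_le hmodel hX hε hY hζ n) le_rfl

/-- Lower bound on the joint mean-square error with unknown error probabilities. The mean-square
errors are taken in `[0, ∞]`, so no moment of the prior is assumed. The policy is any admissible
one, in particular an optimal one. -/
theorem theorem8 {Ω : Type*} [MeasurableSpace Ω] (μ : Measure Ω) [IsProbabilityMeasure μ]
    {d M : ℕ} (𝒳 : Set (EuclideanSpace ℝ (Fin d)))
    -- the prior density of `(X*, ε*)`, on `𝒳 × [0, 1/2)^M`, with finite entropy
    (p₀ : Param d M → ℝ) (hp₀_meas : Measurable p₀) (hp₀_nonneg : ∀ z, 0 ≤ p₀ z)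
    (hp₀_supp : ∀ z, ¬ (z.1 ∈ 𝒳 ∧ ∀ m, z.2 m ∈ Set.Ico (0 : ℝ) (1 / 2)) → p₀ z = 0)
    (hp₀_entropy : Integrable (fun z => Real.negMulLog (p₀ z)))
    -- the target, the error probabilities and the responses
    (X : Ω → EuclideanSpace ℝ (Fin d)) (hX : Measurable X)
    (ε : Ω → EuclideanSpace ℝ (Fin M)) (hε : Measurable ε)
    (Y : ℕ → Ω → Response M) (hY : ∀ k, Measurable (Y k))
    (hprior : μ.map (fun ω => (X ω, ε ω)) = volume.withDensity (fun z => ENNReal.ofReal (p₀ z)))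
    -- the policy, with query regions that are unions of at most `J k m` rectangles in `𝒳`
    (J : ℕ → Fin M → ℕ) (ζ : Policy d M) (hζ : ∀ k h, Admissible 𝒳 (J k) (ζ k h))
    (hmodel : FollowsModel μ X ε Y ζ) (n : ℕ) :
    ENNReal.ofReal
        (Real.exp (2 * diffEntropy p₀ / d) / (2 * Real.pi * Real.exp 1) * d *
          Real.exp (-(2 * n * averageGain μ X ε Y 𝒳 J n) / d))
      ≤ ∫⁻ ω, ‖(μ[X | info Y n]) ω - X ω‖ₑ ^ 2 ∂μ
        + ∫⁻ ω, ‖(μ[ε | info Y n]) ω - ε ω‖ₑ ^ 2 ∂μ := by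
  exact (theorem8_general μ 𝒳 p₀ hp₀_meas hp₀_nonneg hp₀_entropy X hX ε hε Y hY hprior J ζ hζ
    hmodel n stronglyMeasurable_condExp).trans le_self_add
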